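/- Let $\mathfrak g$ be a finite-dimensional real Lie algebra with a Hermitian structure $(J,g)$: $g=\langle\,,\rangle$ is an inner product on $\mathfrak g$ and $J:\mathfrak g\to\mathfrak g$ is a linear map with $J^2=-I$, $\langle Jx,Jy\rangle=\langle x,y\rangle$ and $[x,y]-[Jx,Jy]+J[Jx,y]+J[x,Jy]=0$ for all $x,y\in\mathfrak g$. Suppose that $g$ is flat, i.e. that the Levi-Civita connection $\nabla$ of the corresponding left-invariant metric, given on $\mathfrak g$ by $2\langle\nabla_xy,z\rangle=\langle[x,y],z\rangle-\langle[y,z],x\rangle+\langle[z,x],y\rangle$, satisfies $\nabla_x\nabla_yz-\nabla_y\nabla_xz-\nabla_{[x,y]}z=0$ for all $x,y,z\in\mathfrak g$. Then $g$ is Kähler: the form $\omega(x,y)=\langle Jx,y\rangle$ is closed, i.e. $\omega([x,y],z)+\omega([y,z],x)+\omega([z,x],y)=0$ for all $x,y,z\in\mathfrak g$. Moreover $\mathfrak g$ is an orthogonal direct sum $\mathfrak h\oplus\mathfrak z\oplus\mathfrak g'$, where $\mathfrak z$ is the center of $\mathfrak g$, $\mathfrak g'=[\mathfrak g,\mathfrak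 g]$ is the commutator, which is abelian, and $\mathfrak h$ is an abelian subalgebra, such that: 1. $J\mathfrak g'=\mathfrak g'$, and $\mathfrak g'$ has an orthonormal basis $\{\varepsilon_1,\dots,\varepsilon_{2p}\}$ with $\varepsilon_{2i}=J\varepsilon_{2i-1}$ for $1\le i\le p$; 2. $[x,\varepsilon_{2i-1}]=f_i(x)\varepsilon_{2i}$ and $[x,\varepsilon_{2i}]=-f_i(x)\varepsilon_{2i-1}$ for all $1\le i\le p$ and $x\in\mathfrak h$, where $f=(f_1,\dots,f_p):\mathfrak h\to\mathbb R^p$ is an injective linear map with each $f_i\not\equiv0$; 3. there are orthogonal decompositions $\mathfrak h=(\mathfrak h\cap J\mathfrak h)\oplus\mathfrak h_1$ and $\mathfrak z=(\mathfrak z\cap J\mathfrak z)\oplus\mathfrak z_1$ such that $J(\mathfrak h_1\oplus\mathfrak z_1)=\mathfrak h_1\oplus\mathfrak z_1$ and the map that sends $x\in\mathfrak h_1$ to the $\mathfrak z_1$-component of $Jx$ is an isomorphism $\mathfrak h_1\to\mathfrak z_1$. -/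

import Mathlib

/-- An inner product on a real Lie algebra, as a positive definite symmetric bilinear form.
It is the same thing as a left-invariant Riemannian metric on a Lie group with this Lie algebra. -/
structure LieMetric (𝔤 : Type*) [LieRing 𝔤] [LieAlgebra ℝ 𝔤] where
  g : LinearMap.BilinForm ℝ 𝔤
  g_symm : ∀ x y : 𝔤, g x y = g y x
  g_pos : ∀ x : 𝔤, x ≠ 0 → 0 < g x x

namespace LieMetric

variable {𝔤 : Type*} [LieRing 𝔤] [LieAlgebra ℝ 𝔤]

theorem nondegenerate (m : LieMetric 𝔤) : m.g.Nondegenerate := by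
  refine ⟨fun x hx => ?_, fun x hx => ?_⟩ <;>
  · by_contra h
    exact absurd (hx x) (m.g_pos x h).ne'

/-- The linear functional `z ↦ (⟨[x, y], z⟩ - ⟨[y, z], x⟩ + ⟨[z, x], y⟩) / 2`,
the right-hand side of the Koszul formula for left-invariant vector fields. -/
noncomputable def koszul (m : LieMetric 𝔤) (x y : 𝔤) : Module.Dual ℝ 𝔤 :=
  (2⁻¹ : ℝ) • (m.g ⁅x, y⁆ - m.g x ∘ₗ (LieAlgebra.ad ℝ 𝔤 y : 𝔤 →ₗ[ℝ] 𝔤)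
    - m.g y ∘ₗ (LieAlgebra.ad ℝ 𝔤 x : 𝔤 →ₗ[ℝ] 𝔤))

/-- The Levi-Civita connection on left-invariant vector fields: `∇_x y` is the vector that
represents the Koszul functional. -/
noncomputable def leviCivita [FiniteDimensional ℝ 𝔤] (m : LieMetric 𝔤) (x y : 𝔤) : 𝔤 :=
  (m.g.toDual m.nondegenerate).symm (m.koszul x y)

theorem g_leviCivita [FiniteDimensional ℝ 𝔤] (m : LieMetric 𝔤) (x y z : 𝔤) :
    m.g (m.leviCivita x y) z = 2⁻¹ * (m.g ⁅x, y⁆ z - m.g ⁅y, z⁆ x + m.g ⁅z, x⁆ y) := by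
  have h : m.g (m.leviCivita x y) z = m.koszul x y z := by
    simp [leviCivita, LinearMap.BilinForm.apply_toDual_symm_apply]
  have h' : m.g ⁅z, x⁆ y = -m.g y ⁅x, z⁆ := by
    rw [← lie_skew z x, m.g_symm, map_neg]
  rw [h, h', m.g_symm ⁅y, z⁆ x]
  simp only [koszul, LinearMap.smul_apply, LinearMap.sub_apply, LinearMap.comp_apply,
    LieAlgebra.ad_apply, smul_eq_mul]
  ring

theorem eq_of_forall_g (m : LieMetric 𝔤) {u v : 𝔤} (h : ∀ z, m.g u z = m.g v z) : u = v := by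
  by_contra hne
  have h1 := m.g_pos (u - v) (sub_ne_zero.mpr hne)
  have h2 : m.g (u - v) (u - v) = 0 := by
    rw [m.g.map_sub, LinearMap.sub_apply, h, sub_self]
  exact h1.ne' h2

/-- The connection is torsion-free. -/
theorem leviCivita_torsion_free [FiniteDimensional ℝ 𝔤] (m : LieMetric 𝔤) (x y : 𝔤) :
    m.leviCivita x y - m.leviCivita y x = ⁅x, y⁆ := by
  apply m.eq_of_forall_g
  intro z
  rw [map_sub, LinearMap.sub_apply, g_leviCivita, g_leviCivita, ← lie_skew y x, ← lie_skew x z,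
    ← lie_skew z y]
  simp only [map_neg, LinearMap.neg_apply]
  ring

/-- The connection is metric. -/
theorem leviCivita_metric [FiniteDimensional ℝ 𝔤] (m : LieMetric 𝔤) (x y z : 𝔤) :
    m.g (m.leviCivita x y) z + m.g y (m.leviCivita x z) = 0 := by
  rw [m.g_symm y, g_leviCivita, g_leviCivita, ← lie_skew y x, ← lie_skew x z, ← lie_skew z y]
  simp only [map_neg, LinearMap.neg_apply]
  ring

/-- Riemannian flatness: the curvature
`R(x, y) z = ∇_x ∇_y z - ∇_y ∇_x z - ∇_[x, y] z` of the Levi-Civita connection vanishes. -/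
def IsFlat [FiniteDimensional ℝ 𝔤] (m : LieMetric 𝔤) : Prop :=
  ∀ x y z : 𝔤,
    m.leviCivita x (m.leviCivita y z) - m.leviCivita y (m.leviCivita x z)
      - m.leviCivita ⁅x, y⁆ z = 0

end LieMetric

/-- A Hermitian structure on a real Lie algebra: an integrable complex structure `J` and an
inner product for which `J` is orthogonal. -/
structure HermitianStructure (𝔤 : Type*) [LieRing 𝔤] [LieAlgebra ℝ 𝔤] extends LieMetric 𝔤 where
  J : 𝔤 →ₗ[ℝ] 𝔤
  J_sq : ∀ x : 𝔤, J (J x) = -x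
  J_integrable : ∀ x y : 𝔤, ⁅x, y⁆ - ⁅J x, J y⁆ + J ⁅J x, y⁆ + J ⁅x, J y⁆ = 0
  g_J : ∀ x y : 𝔤, g (J x) (J y) = g x y

namespace HermitianStructure

variable {𝔤 : Type*} [LieRing 𝔤] [LieAlgebra ℝ 𝔤]

/-- The fundamental 2-form `ω(x, y) = ⟨J x, y⟩`. -/
def omega (H : HermitianStructure 𝔤) (x y : 𝔤) : ℝ := H.g (H.J x) y

/-- The metric is Kähler: the left-invariant form `ω` is closed, where
`dω(x, y, z) = -ω([x, y], z) - ω([y, z], x) - ω([z, x], y)`. -/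
def IsKahler (H : HermitianStructure 𝔤) : Prop :=
  ∀ x y z : 𝔤, -H.omega ⁅x, y⁆ z - H.omega ⁅y, z⁆ x - H.omega ⁅z, x⁆ y = 0

/-- The two subspaces are perpendicular. -/
def Perp (H : HermitianStructure 𝔤) (A B : Submodule ℝ 𝔤) : Prop :=
  ∀ x ∈ A, ∀ y ∈ B, H.g x y = 0

variable (𝔤) in
/-- The center of `𝔤`, as a subspace. -/
def centerSpace : Submodule ℝ 𝔤 := (LieAlgebra.center ℝ 𝔤).toSubmodule

variable (𝔤) in
/-- The commutator `[𝔤, 𝔤]`, as a subspace. -/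
def commutatorSpace : Submodule ℝ 𝔤 := (⁅(⊤ : LieIdeal ℝ 𝔤), (⊤ : LieIdeal ℝ 𝔤)⁆).toSubmodule

/-- The structure of Kähler flat Lie algebras: `𝔤` is the orthogonal direct sum of an abelian
subalgebra `h`, the center `z` and the (abelian) commutator `g'`, with the listed properties.
The orthonormal basis of `g'` is `ε 0, J (ε 0), …, ε (p-1), J (ε (p-1))`. -/
def HasKahlerFlatStructure (H : HermitianStructure 𝔤) : Prop :=
  ∃ h : Submodule ℝ 𝔤,
    -- orthogonal direct sum of an abelian subalgebra, the center and the abelian commutator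
    (h ⊔ centerSpace 𝔤 ⊔ commutatorSpace 𝔤 = ⊤ ∧
      H.Perp h (centerSpace 𝔤) ∧ H.Perp h (commutatorSpace 𝔤) ∧
      H.Perp (centerSpace 𝔤) (commutatorSpace 𝔤)) ∧
    (∀ x ∈ h, ∀ y ∈ h, ⁅x, y⁆ = 0) ∧
    (∀ x ∈ commutatorSpace 𝔤, ∀ y ∈ commutatorSpace 𝔤, ⁅x, y⁆ = 0) ∧
    -- the commutator is `J`-invariant, and `h` acts on it by simultaneous rotations
    (commutatorSpace 𝔤).map H.J = commutatorSpace 𝔤 ∧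
    (∃ (p : ℕ) (ε : Fin p → 𝔤) (f : h →ₗ[ℝ] (Fin p → ℝ)),
      (∀ i j, H.g (ε i) (ε j) = if i = j then 1 else 0) ∧
      (∀ i j, H.g (H.J (ε i)) (H.J (ε j)) = if i = j then 1 else 0) ∧
      (∀ i j, H.g (ε i) (H.J (ε j)) = 0) ∧
      Submodule.span ℝ (Set.range ε ∪ Set.range (fun i => H.J (ε i))) = commutatorSpace 𝔤 ∧
      (∀ (x : h) (i : Fin p), ⁅(x : 𝔤), ε i⁆ = f x i • H.J (ε i)) ∧
      (∀ (x : h) (i : Fin p), ⁅(x : 𝔤), H.J (ε i)⁆ = -(f x i • ε i)) ∧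
      Function.Injective f ∧
      (∀ i : Fin p, ∃ x : h, f x i ≠ 0)) ∧
    -- the position of `J` relative to `h ⊕ z`
    (∃ h₁ z₁ : Submodule ℝ 𝔤,
      (h ⊓ h.map H.J) ⊔ h₁ = h ∧ H.Perp (h ⊓ h.map H.J) h₁ ∧
      (centerSpace 𝔤 ⊓ (centerSpace 𝔤).map H.J) ⊔ z₁ = centerSpace 𝔤 ∧
      H.Perp (centerSpace 𝔤 ⊓ (centerSpace 𝔤).map H.J) z₁ ∧
      (h₁ ⊔ z₁).map H.J = h₁ ⊔ z₁ ∧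
      -- `φ x` is the `z₁`-component of `J x` in `h₁ ⊕ z₁`
      (∃ φ : h₁ ≃ₗ[ℝ] z₁, ∀ x : h₁, H.J (x : 𝔤) - (φ x : 𝔤) ∈ h₁))

end HermitianStructure

/-! Flatness says that `∇` is a representation of `𝔤` by skew operators. Let `u` be its kernel
(`nullity`) and `b` the orthogonal complement of `u` (`conullity`). Every `∇_y` preserves both, and
`-tr (∇_x ∇_y)` is an invariant form, positive definite on `b`. A Casimir argument
(`connection_eq_zero_of_flat`) then gives `∇_b b = 0`. Hence `b` is abelian, `[𝔤, 𝔤] ⊆ u`, and all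
the operators `∇_x` commute.

Integrability means `∇_{Jx} J = J ∇_x J`. Since `∇_x` and `∇_{Jx}` commute, a trace computation
gives `tr ((∇_x J)²) = 0`. The operator `∇_x J` is skew, so it vanishes (`nablaJ_eq_zero`). Thus `J`
is parallel and the metric is Kähler.

For the structure, take `b` as the abelian subalgebra `h`. The orthogonal complement of `𝔤'` is the
space of parallel vectors (`∇_y x = 0` for all `y`), which is `b ⊕ z`, with `z` its intersection
with `u`. As `J` commutes with `∇`, both `𝔤'` and `b ⊕ z` are `J`-invariant. The symmetric operators
`J ∇_x` commute with each other and with `J`, and a unitary eigenbasis of `𝔤'` for them shows the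
rotations. The last property is linear algebra of an orthogonal `J` on an orthogonal sum of two
subspaces. -/

/-! ### Linear algebra of positive definite forms -/

section PositiveForm

variable {V : Type*} [AddCommGroup V] [Module ℝ V] [FiniteDimensional ℝ V]

/-- The inner product space structure data of a positive definite symmetric bilinear form. -/
@[reducible]
def LinearMap.BilinForm.innerCore {V : Type*} [AddCommGroup V] [Module ℝ V]
    (B : LinearMap.BilinForm ℝ V) (hs : ∀ x y, B x y = B y x) (hp : ∀ x, x ≠ 0 → 0 < B x x) :
    InnerProductSpace.Core ℝ V where
  inner x y := B x y
  conj_inner_symm x y := by simp [hs x y]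
  re_inner_nonneg x := by
    rcases eq_or_ne x 0 with rfl | h
    · simp
    · simpa using (hp x h).le
  add_left x y z := by simp
  smul_left x y r := by simp
  definite x h := by
    by_contra hx
    exact (hp x hx).ne' h

theorem LinearMap.BilinForm.exists_orthonormal_basis (B : LinearMap.BilinForm ℝ V)
    (hs : ∀ x y, B x y = B y x) (hp : ∀ x, x ≠ 0 → 0 < B x x) :
    ∃ (n : ℕ) (e : Module.Basis (Fin n) ℝ V), ∀ i j, B (e i) (e j) = if i = j then 1 else 0 := by
  let _ : NormedAddCommGroup V := (B.innerCore hs hp).toNormedAddCommGroup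
  let _ : InnerProductSpace ℝ V := InnerProductSpace.ofCore (B.innerCore hs hp).toCore
  refine ⟨_, (stdOrthonormalBasis ℝ V).toBasis, fun i j => ?_⟩
  have h := orthonormal_iff_ite.mp (stdOrthonormalBasis ℝ V).orthonormal i j
  rw [OrthonormalBasis.coe_toBasis]
  exact h

theorem LinearMap.BilinForm.exists_joint_eigenvector [Nontrivial V] (B : LinearMap.BilinForm ℝ V)
    (hs : ∀ x y, B x y = B y x) (hp : ∀ x, x ≠ 0 → 0 < B x x) {ι : Type*}
    (S : ι → V →ₗ[ℝ] V) (hS : ∀ k x y, B (S k x) y = B x (S k y))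
    (hc : ∀ k l x, S k (S l x) = S l (S k x)) :
    ∃ (v : V) (χ : ι → ℝ), v ≠ 0 ∧ ∀ k, S k v = χ k • v := by
  let _ : NormedAddCommGroup V := (B.innerCore hs hp).toNormedAddCommGroup
  let _ : InnerProductSpace ℝ V := InnerProductSpace.ofCore (B.innerCore hs hp).toCore
  have hT : ∀ k, (S k).IsSymmetric := fun k x y => hS k x y
  have htop := LinearMap.IsSymmetric.iSup_iInf_eq_top_of_commute hT
    (fun k l _ => LinearMap.ext (hc k l))
  by_contra! hne
  have hbot : ∀ χ : ι → ℝ, ⨅ i, Module.End.eigenspace (S i) (χ i) = ⊥ := by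
    intro χ
    rw [Submodule.eq_bot_iff]
    intro v hv
    by_contra hv0
    obtain ⟨k, hk⟩ := hne v χ hv0
    exact hk (Module.End.mem_eigenspace_iff.mp ((Submodule.mem_iInf _).mp hv k))
  simp only [hbot, iSup_bot] at htop
  exact bot_ne_top htop

section Basis

variable {n : ℕ} {B : LinearMap.BilinForm ℝ V} {e : Module.Basis (Fin n) ℝ V}
  (he : ∀ i j, B (e i) (e j) = if i = j then 1 else 0)

omit [FiniteDimensional ℝ V] in
include he in
theorem LinearMap.BilinForm.repr_orthonormal (x : V) (i : Fin n) : e.repr x i = B x (e i) := by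
  conv_rhs => rw [← e.sum_repr x]
  simp only [map_sum, LinearMap.sum_apply, map_smul, LinearMap.smul_apply, he, smul_eq_mul,
    mul_ite, mul_one, mul_zero, Finset.sum_ite_eq', Finset.mem_univ, if_true]

omit [FiniteDimensional ℝ V] in
include he in
theorem LinearMap.BilinForm.sum_repr_orthonormal (x : V) : ∑ i, B x (e i) • e i = x := by
  simp only [← LinearMap.BilinForm.repr_orthonormal he]
  exact e.sum_repr x

omit [FiniteDimensional ℝ V] in
include he in
theorem LinearMap.BilinForm.trace_eq_sum (T : V →ₗ[ℝ] V) :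
    LinearMap.trace ℝ V T = ∑ i, B (T (e i)) (e i) := by
  rw [LinearMap.trace_eq_matrix_trace ℝ e, Matrix.trace]
  refine Finset.sum_congr rfl fun i _ => ?_
  rw [Matrix.diag_apply, LinearMap.toMatrix_apply, LinearMap.BilinForm.repr_orthonormal he]

end Basis

section Skew

variable {B : LinearMap.BilinForm ℝ V} (hs : ∀ x y, B x y = B y x)
  (hp : ∀ x, x ≠ 0 → 0 < B x x)


include hs hp in
theorem LinearMap.BilinForm.trace_eq_zero_of_skew {T : V →ₗ[ℝ] V}
    (hT : ∀ x y, B (T x) y = -B x (T y)) : LinearMap.trace ℝ V T = 0 := by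
  obtain ⟨n, e, he⟩ := B.exists_orthonormal_basis hs hp
  rw [LinearMap.BilinForm.trace_eq_sum he]
  refine Finset.sum_eq_zero fun i _ => ?_
  have := hT (e i) (e i)
  rw [hs (e i)] at this
  linarith

omit [FiniteDimensional ℝ V] in
include hp in
theorem LinearMap.BilinForm.nonneg_apply_self (x : V) : 0 ≤ B x x := by
  rcases eq_or_ne x 0 with rfl | h
  · simp
  · exact (hp x h).le

include hs hp in
theorem LinearMap.BilinForm.trace_comp_self_nonpos_of_skew {T : V →ₗ[ℝ] V}
    (hT : ∀ x y, B (T x) y = -B x (T y)) : LinearMap.trace ℝ V (T ∘ₗ T) ≤ 0 := by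
  obtain ⟨n, e, he⟩ := B.exists_orthonormal_basis hs hp
  rw [LinearMap.BilinForm.trace_eq_sum he]
  refine Finset.sum_nonpos fun i _ => ?_
  rw [LinearMap.comp_apply, hT]
  exact neg_nonpos.mpr (LinearMap.BilinForm.nonneg_apply_self hp _)

include hs hp in
theorem LinearMap.BilinForm.eq_zero_of_skew_of_trace_comp_self {T : V →ₗ[ℝ] V}
    (hT : ∀ x y, B (T x) y = -B x (T y)) (h0 : LinearMap.trace ℝ V (T ∘ₗ T) = 0) : T = 0 := by
  obtain ⟨n, e, he⟩ := B.exists_orthonormal_basis hs hp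
  rw [LinearMap.BilinForm.trace_eq_sum he] at h0
  have hterm : ∀ i, B ((T ∘ₗ T) (e i)) (e i) = -B (T (e i)) (T (e i)) := fun i => hT _ _
  simp only [hterm, Finset.sum_neg_distrib, neg_eq_zero] at h0
  rw [Finset.sum_eq_zero_iff_of_nonneg
    (fun i _ => LinearMap.BilinForm.nonneg_apply_self hp _)] at h0
  refine e.ext fun i => ?_
  by_contra hne
  exact (hp _ hne).ne' (h0 i (Finset.mem_univ i))

include hs hp in
theorem LinearMap.BilinForm.isCompl_orthogonal_of_pos (W : Submodule ℝ V) :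
    IsCompl W (B.orthogonal W) := by
  have hr : B.IsRefl := fun x y h => by rw [hs y x, h]
  rw [LinearMap.BilinForm.isCompl_orthogonal_iff_disjoint hr, Submodule.disjoint_def]
  intro x hx hx'
  by_contra hne
  exact (hp x hne).ne' (hx' x hx)

include hs hp in
-- Induction on dimension: a joint eigenvector `u` spans a complex line with `J u`, and the
-- orthogonal complement of this line is again stable under `J` and all `S k`.
theorem LinearMap.BilinForm.exists_unitary_eigenbasis {ι : Type*} {J : V →ₗ[ℝ] V}
    (hJ : ∀ x, J (J x) = -x) (hBJ : ∀ x y, B (J x) (J y) = B x y)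
    {S : ι → V →ₗ[ℝ] V} (hS : ∀ k x y, B (S k x) y = B x (S k y))
    (hc : ∀ k l x, S k (S l x) = S l (S k x)) (hSJ : ∀ k x, S k (J x) = J (S k x))
    (W : Submodule ℝ V) (hWJ : ∀ x ∈ W, J x ∈ W) (hWS : ∀ k, ∀ x ∈ W, S k x ∈ W) :
    ∃ (p : ℕ) (ε : Fin p → V) (χ : Fin p → ι → ℝ),
      (∀ i j, B (ε i) (ε j) = if i = j then 1 else 0) ∧ (∀ i j, B (ε i) (J (ε j)) = 0) ∧
      Submodule.span ℝ (Set.range ε ∪ Set.range (fun i => J (ε i))) = W ∧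
      ∀ i k, S k (ε i) = χ i k • ε i := by
  induction hn : Module.finrank ℝ W using Nat.strong_induction_on generalizing W with
  | _ n ih =>
  rcases eq_or_ne W ⊥ with rfl | hW
  · refine ⟨0, Fin.elim0, Fin.elim0, fun i => i.elim0, fun i => i.elim0, ?_, fun i => i.elim0⟩
    simp
  have hnt : Nontrivial W := (Submodule.nontrivial_iff_ne_bot).mpr hW
  obtain ⟨v, χ₀, hv0, hvχ⟩ : ∃ (v : V) (χ : ι → ℝ), (v ∈ W ∧ v ≠ 0) ∧ ∀ k, S k v = χ k • v := by
    obtain ⟨v, χ, hv0, hv⟩ := (B.restrict W).exists_joint_eigenvector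
      (fun x y => hs x y) (fun x hx => hp x (by simpa using hx))
      (fun k => (S k).restrict (hWS k)) (fun k x y => hS k x y)
      (fun k l x => Subtype.ext (hc k l x))
    refine ⟨v, χ, ⟨v.2, by simpa using hv0⟩, fun k => ?_⟩
    exact congrArg Subtype.val (hv k)
  obtain ⟨u, huW, huu, huχ⟩ : ∃ u ∈ W, B u u = 1 ∧ ∀ k, S k u = χ₀ k • u := by
    have hpos := hp v hv0.2
    refine ⟨(√(B v v))⁻¹ • v, W.smul_mem _ hv0.1, ?_, fun k => ?_⟩
    · simp only [map_smul, LinearMap.smul_apply, smul_eq_mul]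
      have h1 := Real.mul_self_sqrt hpos.le
      have h2 := (Real.sqrt_pos.mpr hpos).ne'
      field_simp
      nlinarith
    · rw [map_smul, hvχ, smul_comm]
  have hJskew : ∀ x y, B (J x) y = -B x (J y) := by
    intro x y
    rw [← hBJ x (J y), hJ]; simp
  have huJ : B u (J u) = 0 := by
    have := hJskew u u
    rw [hs] at this
    linarith
  -- Stability uses that `J` is skew and that `J u` is an eigenvector with the same eigenvalues as
  -- `u`.
  let W' : Submodule ℝ V := W ⊓ LinearMap.ker (B u) ⊓ LinearMap.ker (B (J u))
  have hmem : ∀ x, x ∈ W' ↔ (x ∈ W ∧ B u x = 0) ∧ B (J u) x = 0 := fun x => Iff.rfl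
  have hlt : W' < W := by
    refine lt_of_le_of_ne (fun x hx => ((hmem x).mp hx).1.1) fun h => ?_
    have : u ∈ W' := h ▸ huW
    rw [hmem] at this
    linarith [this.1.2]
  obtain ⟨p, ε, χ, h1, h2, h3, h4⟩ := ih _ (hn ▸ Submodule.finrank_lt_finrank_of_lt hlt) W'
    (fun x hx => by
      rw [hmem] at hx ⊢
      refine ⟨⟨hWJ x hx.1.1, ?_⟩, ?_⟩
      · linarith [hJskew u x, hx.2]
      · rw [hBJ]; exact hx.1.2)
    (fun k x hx => by
      rw [hmem] at hx ⊢
      refine ⟨⟨hWS k x hx.1.1, ?_⟩, ?_⟩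
      · rw [← hS, huχ]; simp [hx.1.2]
      · rw [← hS, hSJ, huχ]; simp [hx.2]) rfl
  have hεW : ∀ i, ε i ∈ W' := fun i => by
    rw [← h3]; exact Submodule.subset_span (Or.inl ⟨i, rfl⟩)
  have hε : ∀ i, B u (ε i) = 0 ∧ B (J u) (ε i) = 0 := fun i =>
    ⟨((hmem _).mp (hεW i)).1.2, ((hmem _).mp (hεW i)).2⟩
  have hεJ : ∀ i, B u (J (ε i)) = 0 := fun i => by linarith [hJskew u (ε i), (hε i).2]
  refine ⟨p + 1, Fin.cons u ε, Fin.cons χ₀ χ, ?_, ?_, ?_, ?_⟩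
  · intro i j
    refine Fin.cases ?_ (fun i => ?_) i <;> refine Fin.cases ?_ (fun j => ?_) j
    · simp [huu]
    · simp [(hε j).1, (Fin.succ_ne_zero j).symm]
    · simp [hs _ u, (hε i).1]
    · simp [h1]
  · intro i j
    refine Fin.cases ?_ (fun i => ?_) i <;> refine Fin.cases ?_ (fun j => ?_) j
    · simp [huJ]
    · simp [hεJ]
    · simp [hs _ (J u), (hε i).2]
    · simp [h2]
  · apply le_antisymm
    · rw [Submodule.span_le]
      rintro x (⟨i, rfl⟩ | ⟨i, rfl⟩)
      · refine Fin.cases ?_ (fun i => ?_) i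
        · simpa using huW
        · simpa using hlt.le (hεW i)
      · refine Fin.cases ?_ (fun i => ?_) i
        · simpa using hWJ u huW
        · simpa using hWJ _ (hlt.le (hεW i))
    · intro x hx
      have hx' : x - B u x • u - B (J u) x • J u ∈ W' := by
        rw [hmem]
        refine ⟨⟨W.sub_mem (W.sub_mem hx (W.smul_mem _ huW)) (W.smul_mem _ (hWJ _ huW)), ?_⟩, ?_⟩
        · simp [huu, huJ]
        · simp [hBJ, huu, hs (J u) u, huJ]
      have hle : W' ≤ Submodule.span ℝ (Set.range (Fin.cons u ε : Fin (p + 1) → V) ∪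
          Set.range (fun i => J ((Fin.cons u ε : Fin (p + 1) → V) i))) := by
        rw [← h3]
        apply Submodule.span_mono
        rintro y (⟨i, rfl⟩ | ⟨i, rfl⟩)
        · exact Or.inl ⟨i.succ, by simp⟩
        · exact Or.inr ⟨i.succ, by simp⟩
      have hu : u ∈ Submodule.span ℝ (Set.range (Fin.cons u ε : Fin (p + 1) → V) ∪
          Set.range (fun i => J ((Fin.cons u ε : Fin (p + 1) → V) i))) :=
        Submodule.subset_span (Or.inl ⟨0, by simp⟩)
      have hJu : J u ∈ Submodule.span ℝ (Set.range (Fin.cons u ε : Fin (p + 1) → V) ∪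
          Set.range (fun i => J ((Fin.cons u ε : Fin (p + 1) → V) i))) :=
        Submodule.subset_span (Or.inr ⟨0, by simp⟩)
      have := Submodule.add_mem _ (Submodule.add_mem _ (hle hx')
        (Submodule.smul_mem _ (B (J u) x) hJu)) (Submodule.smul_mem _ (B u x) hu)
      convert this using 1
      abel
  · intro i k
    refine Fin.cases ?_ (fun i => ?_) i
    · simp [huχ]
    · simp [h4]

end Skew

end PositiveForm

/-- A torsion-free flat metric connection on a Lie algebra that has an invariant inner product
vanishes: with `w = ∑ ∇_{e_i} e_i`, the operator `x ↦ ∇_x w` is the Casimir operator. -/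
theorem LinearMap.BilinForm.connection_eq_zero_of_flat {V : Type*} [AddCommGroup V] [Module ℝ V]
    [FiniteDimensional ℝ V] {B β : LinearMap.BilinForm ℝ V}
    (hBs : ∀ x y, B x y = B y x) (hBp : ∀ x, x ≠ 0 → 0 < B x x)
    (hβs : ∀ x y, β x y = β y x) (hβp : ∀ x, x ≠ 0 → 0 < β x x)
    (D : V →ₗ[ℝ] V →ₗ[ℝ] V) (hD : ∀ x y z, B (D x y) z = -B y (D x z))
    (hflat : ∀ x y z, D x (D y z) - D y (D x z) = D (D x y - D y x) z)
    (hinv : ∀ x y z, β (D x y - D y x) z = -β y (D x z - D z x)) : D = 0 := by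
  obtain ⟨n, e, he⟩ := β.exists_orthonormal_basis hβs hβp
  set w := ∑ i, D (e i) (e i) with hw
  have hcas : D.flip w = ∑ i, D (e i) ∘ₗ D (e i) := by
    ext x
    let a : Fin n → Fin n → ℝ := fun i j => β (D x (e i) - D (e i) x) (e j)
    have ha : ∀ i j, a j i = -a i j := fun i j => by
      simp only [a]
      rw [hinv, hβs]
    have hc : ∀ i, D x (e i) - D (e i) x = ∑ j, a i j • e j := fun i =>
      (LinearMap.BilinForm.sum_repr_orthonormal he _).symm
    -- Invariance of `β` makes the coefficients `a i j` skew, and they are contracted with an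
    -- expression symmetric in `i` and `j`.
    have hX : ∑ i, (D (D x (e i) - D (e i) x) (e i) + D (e i) (D x (e i) - D (e i) x)) = 0 := by
      have h1 : ∑ i, (D (D x (e i) - D (e i) x) (e i) + D (e i) (D x (e i) - D (e i) x))
          = ∑ i, ∑ j, a i j • (D (e j) (e i) + D (e i) (e j)) := by
        refine Finset.sum_congr rfl fun i _ => ?_
        rw [hc]
        simp only [map_sum, LinearMap.sum_apply, map_smul, LinearMap.smul_apply, smul_add,
          Finset.sum_add_distrib]
      have h2 : ∑ i, ∑ j, a i j • (D (e j) (e i) + D (e i) (e j))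
          = -∑ i, ∑ j, a i j • (D (e j) (e i) + D (e i) (e j)) := by
        conv_lhs => rw [Finset.sum_comm]
        simp only [← Finset.sum_neg_distrib]
        refine Finset.sum_congr rfl fun i _ => Finset.sum_congr rfl fun j _ => ?_
        rw [ha i j, neg_smul, add_comm]
      rw [h1]
      have h3 := eq_neg_iff_add_eq_zero.mp h2
      rw [← two_smul ℝ] at h3
      exact (smul_eq_zero_iff_right two_ne_zero).mp h3
    have hterm : ∀ i, D x (D (e i) (e i)) = D (e i) (D (e i) x) +
        (D (D x (e i) - D (e i) x) (e i) + D (e i) (D x (e i) - D (e i) x)) := fun i => by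
      rw [← hflat x (e i) (e i), map_sub]
      abel
    rw [LinearMap.flip_apply, hw, map_sum, Finset.sum_congr rfl fun i _ => hterm i,
      Finset.sum_add_distrib, hX, add_zero, LinearMap.sum_apply]
    rfl
  -- `D w` is skew for `B`, while `D w - D.flip w`, the adjoint action of `w`, is skew for `β`; both
  -- are traceless.
  have htr : LinearMap.trace ℝ V (D.flip w) = 0 := by
    have h1 := LinearMap.BilinForm.trace_eq_zero_of_skew hBs hBp (hD w)
    have h2 : LinearMap.trace ℝ V (D w - D.flip w) = 0 :=
      LinearMap.BilinForm.trace_eq_zero_of_skew hβs hβp (hinv w)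
    rw [map_sub, h1, zero_sub, neg_eq_zero] at h2
    exact h2
  rw [hcas, map_sum, Finset.sum_eq_zero_iff_of_nonpos fun i _ =>
    LinearMap.BilinForm.trace_comp_self_nonpos_of_skew hBs hBp (hD (e i))] at htr
  exact e.ext fun i => LinearMap.BilinForm.eq_zero_of_skew_of_trace_comp_self hBs hBp (hD (e i))
    (htr i (Finset.mem_univ i))

/-! ### Flat metrics: the kernel of the connection and its complement -/

namespace LieMetric

variable {𝔤 : Type*} [LieRing 𝔤] [LieAlgebra ℝ 𝔤] [FiniteDimensional ℝ 𝔤] (m : LieMetric 𝔤)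

/-- The Levi-Civita connection as a bilinear map. -/
noncomputable def nabla : 𝔤 →ₗ[ℝ] 𝔤 →ₗ[ℝ] 𝔤 :=
  LinearMap.mk₂ ℝ m.leviCivita
    (fun x x' y => m.eq_of_forall_g fun z => by
      simp only [g_leviCivita, map_add, LinearMap.add_apply, add_lie, lie_add]; ring)
    (fun c x y => m.eq_of_forall_g fun z => by
      simp only [g_leviCivita, map_smul, LinearMap.smul_apply, smul_lie, lie_smul, smul_eq_mul]
      ring)
    (fun x y y' => m.eq_of_forall_g fun z => by
      simp only [g_leviCivita, map_add, LinearMap.add_apply, add_lie, lie_add]; ring)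
    (fun c x y => m.eq_of_forall_g fun z => by
      simp only [g_leviCivita, map_smul, LinearMap.smul_apply, smul_lie, lie_smul, smul_eq_mul]
      ring)

theorem nabla_torsion_free (x y : 𝔤) : m.nabla x y - m.nabla y x = ⁅x, y⁆ :=
  m.leviCivita_torsion_free x y

theorem nabla_skew (x y z : 𝔤) : m.g (m.nabla x y) z = -m.g y (m.nabla x z) :=
  eq_neg_of_add_eq_zero_left (m.leviCivita_metric x y z)

/-- The vectors `x` with `∇_x = 0`. -/
noncomputable def nullity : Submodule ℝ 𝔤 := LinearMap.ker m.nabla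

variable {m} in
theorem mem_nullity {x : 𝔤} : x ∈ m.nullity ↔ ∀ y, m.nabla x y = 0 := by
  rw [nullity, LinearMap.mem_ker, LinearMap.ext_iff]
  rfl

/-- The orthogonal complement of the nullity. -/
noncomputable def conullity : Submodule ℝ 𝔤 := m.g.orthogonal m.nullity

variable {m} in
theorem mem_conullity {x : 𝔤} : x ∈ m.conullity ↔ ∀ y ∈ m.nullity, m.g y x = 0 := Iff.rfl

theorem isCompl_nullity_conullity : IsCompl m.nullity m.conullity :=
  LinearMap.BilinForm.isCompl_orthogonal_of_pos m.g_symm m.g_pos _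

variable {m}

theorem IsFlat.nabla_comm_sub (h : m.IsFlat) (x y z : 𝔤) :
    m.nabla x (m.nabla y z) - m.nabla y (m.nabla x z) = m.nabla ⁅x, y⁆ z :=
  sub_eq_zero.mp (h x y z)

/-- If `∇_x = 0`, then `∇_y x = [y, x]`, and the kernel of a representation is an ideal. -/
theorem IsFlat.nabla_mem_nullity (h : m.IsFlat) (y : 𝔤) {x : 𝔤} (hx : x ∈ m.nullity) :
    m.nabla y x ∈ m.nullity := by
  rw [mem_nullity] at hx ⊢
  intro z
  have h1 := m.nabla_torsion_free y x
  rw [hx, sub_zero] at h1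
  rw [h1, ← h.nabla_comm_sub, hx, hx, map_zero, sub_zero]

theorem IsFlat.nabla_mem_conullity (h : m.IsFlat) (y : 𝔤) {x : 𝔤} (hx : x ∈ m.conullity) :
    m.nabla y x ∈ m.conullity := by
  rw [mem_conullity] at hx ⊢
  intro z hz
  have := hx _ (h.nabla_mem_nullity y hz)
  rw [nabla_skew] at this
  linarith

/-- The trace form `(x, y) ↦ -tr (∇_x ∇_y)`. -/
noncomputable def traceForm (m : LieMetric 𝔤) : LinearMap.BilinForm ℝ 𝔤 :=
  LinearMap.mk₂ ℝ (fun x y => -LinearMap.trace ℝ 𝔤 (m.nabla x ∘ₗ m.nabla y))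
    (fun x x' y => by simp only [map_add, LinearMap.add_comp]; ring)
    (fun c x y => by simp only [map_smul, LinearMap.smul_comp, smul_eq_mul]; ring)
    (fun x y y' => by simp only [map_add, LinearMap.comp_add]; ring)
    (fun c x y => by simp only [map_smul, LinearMap.comp_smul, smul_eq_mul]; ring)

theorem traceForm_apply (m : LieMetric 𝔤) (x y : 𝔤) :
    m.traceForm x y = -LinearMap.trace ℝ 𝔤 (m.nabla x ∘ₗ m.nabla y) := rfl

theorem traceForm_symm (m : LieMetric 𝔤) (x y : 𝔤) : m.traceForm x y = m.traceForm y x := by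
  rw [traceForm_apply, traceForm_apply, LinearMap.trace_comp_comm']

theorem traceForm_pos (m : LieMetric 𝔤) {x : 𝔤} (hx : x ∉ m.nullity) : 0 < m.traceForm x x := by
  refine lt_of_le_of_ne (neg_nonneg.mpr
    (LinearMap.BilinForm.trace_comp_self_nonpos_of_skew m.g_symm m.g_pos (m.nabla_skew x))) ?_
  intro h0
  exact hx (LinearMap.BilinForm.eq_zero_of_skew_of_trace_comp_self m.g_symm m.g_pos
    (m.nabla_skew x) (neg_eq_zero.mp h0.symm))

theorem IsFlat.nabla_lie (h : m.IsFlat) (x y : 𝔤) :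
    m.nabla ⁅x, y⁆ = m.nabla x * m.nabla y - m.nabla y * m.nabla x :=
  LinearMap.ext fun z => (h.nabla_comm_sub x y z).symm

theorem IsFlat.traceForm_lie (h : m.IsFlat) (x y z : 𝔤) :
    m.traceForm ⁅x, y⁆ z = -m.traceForm y ⁅x, z⁆ := by
  simp only [traceForm_apply, h.nabla_lie, ← Module.End.mul_eq_comp, sub_mul, mul_sub, map_sub]
  rw [mul_assoc, mul_assoc (m.nabla y) (m.nabla x),
    LinearMap.trace_mul_comm ℝ (m.nabla x) (m.nabla y * m.nabla z), mul_assoc (m.nabla y) (m.nabla z)]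
  ring

/-- The connection restricts to the conullity, where the trace form is an invariant inner product,
so the Casimir argument applies. -/
theorem IsFlat.nabla_conullity (h : m.IsFlat) {x y : 𝔤} (hx : x ∈ m.conullity)
    (hy : y ∈ m.conullity) : m.nabla x y = 0 := by
  let D : m.conullity →ₗ[ℝ] m.conullity →ₗ[ℝ] m.conullity :=
    LinearMap.mk₂ ℝ (fun x y => ⟨m.nabla x y, h.nabla_mem_conullity _ y.2⟩)
      (fun x x' y => Subtype.ext (by simp))
      (fun c x y => Subtype.ext (by simp))
      (fun x y y' => Subtype.ext (by simp))
      (fun c x y => Subtype.ext (by simp))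
  have hc : ∀ x y : m.conullity, ((D x y - D y x : m.conullity) : 𝔤) = ⁅(x : 𝔤), (y : 𝔤)⁆ :=
    fun x y => m.nabla_torsion_free x y
  have hD : D = 0 := by
    refine LinearMap.BilinForm.connection_eq_zero_of_flat (B := m.g.restrict m.conullity)
      (β := m.traceForm.restrict m.conullity) (fun x y => m.g_symm x y)
      (fun x hx => m.g_pos x (by simpa using hx)) (fun x y => m.traceForm_symm x y)
      (fun x hx => m.traceForm_pos fun hx' => hx ?_) D (fun x y z => m.nabla_skew x y z) ?_ ?_
    · exact Subtype.ext
        (Submodule.disjoint_def.mp m.isCompl_nullity_conullity.disjoint _ hx' x.2)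
    · intro x y z
      apply Subtype.ext
      change _ = m.nabla ((D x y - D y x : m.conullity) : 𝔤) z
      rw [hc]
      exact h.nabla_comm_sub x y z
    · intro x y z
      change m.traceForm ((D x y - D y x : m.conullity) : 𝔤) z
        = -m.traceForm y ((D x z - D z x : m.conullity) : 𝔤)
      rw [hc, hc]
      exact h.traceForm_lie x y z
  exact congrArg Subtype.val (LinearMap.congr_fun₂ hD ⟨x, hx⟩ ⟨y, hy⟩)

theorem exists_eq_add (m : LieMetric 𝔤) (x : 𝔤) :
    ∃ u ∈ m.nullity, ∃ b ∈ m.conullity, u + b = x :=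
  Submodule.mem_sup.mp (m.isCompl_nullity_conullity.sup_eq_top ▸ Submodule.mem_top)

theorem IsFlat.lie_mem_nullity (h : m.IsFlat) (x y : 𝔤) : ⁅x, y⁆ ∈ m.nullity := by
  obtain ⟨u, hu, b, hb, rfl⟩ := m.exists_eq_add x
  obtain ⟨u', hu', b', hb', rfl⟩ := m.exists_eq_add y
  rw [← m.nabla_torsion_free]
  simp only [map_add, LinearMap.add_apply, mem_nullity.mp hu, mem_nullity.mp hu',
    h.nabla_conullity hb hb', h.nabla_conullity hb' hb, zero_add, add_zero]
  exact Submodule.sub_mem _ (h.nabla_mem_nullity _ hu') (h.nabla_mem_nullity _ hu)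

/-- The commutator of the two operators is `∇_{[x, y]}`, and brackets lie in the nullity. -/
theorem IsFlat.nabla_comm (h : m.IsFlat) (x y z : 𝔤) :
    m.nabla x (m.nabla y z) = m.nabla y (m.nabla x z) := by
  rw [← sub_eq_zero, h.nabla_comm_sub]
  exact mem_nullity.mp (h.lie_mem_nullity x y) z

end LieMetric

/-! ### The complex structure is parallel -/

namespace HermitianStructure

variable {𝔤 : Type*} [LieRing 𝔤] [LieAlgebra ℝ 𝔤]

theorem g_J_left (H : HermitianStructure 𝔤) (x y : 𝔤) : H.g (H.J x) y = -H.g x (H.J y) := by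
  rw [← H.g_J x (H.J y), H.J_sq]
  simp

variable [FiniteDimensional ℝ 𝔤] (H : HermitianStructure 𝔤)

/-- The covariant derivative `∇_x J`. -/
noncomputable def nablaJ (x : 𝔤) : 𝔤 →ₗ[ℝ] 𝔤 := H.nabla x * H.J - H.J * H.nabla x

theorem nablaJ_apply (x y : 𝔤) : H.nablaJ x y = H.nabla x (H.J y) - H.J (H.nabla x y) := rfl

theorem nablaJ_skew (x y z : 𝔤) : H.g (H.nablaJ x y) z = -H.g y (H.nablaJ x z) := by
  simp only [nablaJ_apply, map_sub, LinearMap.sub_apply, H.g_J_left, H.nabla_skew]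
  ring

theorem nablaJ_J (x y : 𝔤) : H.nablaJ x (H.J y) = -H.J (H.nablaJ x y) := by
  simp only [nablaJ_apply, H.J_sq, map_sub, map_neg]
  abel

/-- Integrability of `J` in terms of the Levi-Civita connection. -/
theorem nablaJ_J_left (x : 𝔤) : H.nablaJ (H.J x) = H.J * H.nablaJ x := by
  have hsym : ∀ x y, H.J (H.nablaJ x y) - H.nablaJ (H.J x) y
      = H.J (H.nablaJ y x) - H.nablaJ (H.J y) x := by
    intro x y
    have h := H.J_integrable x y
    simp only [← H.nabla_torsion_free, map_sub] at h
    simp only [nablaJ_apply, map_sub, H.J_sq]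
    rw [← sub_eq_zero, ← h]
    abel
  have hskew : ∀ x y z, H.g (H.J (H.nablaJ x y) - H.nablaJ (H.J x) y) z
      = -H.g (H.J (H.nablaJ x z) - H.nablaJ (H.J x) z) y := by
    intro x y z
    rw [H.g_symm _ y]
    simp only [map_sub, LinearMap.sub_apply, H.nablaJ_skew, H.g_J_left, H.nablaJ_J, map_neg]
    ring
  ext y
  rw [Module.End.mul_apply, eq_comm, ← sub_eq_zero]
  apply H.eq_of_forall_g
  intro z
  rw [map_zero, LinearMap.zero_apply]
  -- A trilinear expression symmetric in the first two arguments and skew in the last two is zero.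
  have h1 := hskew x y z
  have h2 := hskew y z x
  have h3 := hskew z x y
  rw [hsym x z] at h1
  rw [hsym y x] at h2
  rw [hsym z y] at h3
  linarith

/-- Put `T = ∇_x J` and `B = ∇_{Jx}`. Commutation of `∇_x` with `B` gives `tr (T B) = 0`, and then
`tr (T J B J) = 0` because `T` anticommutes with `J`. Integrability gives `J B J = -B - T`, so `tr
(T²) = 0`, which forces the skew `T` to vanish. -/
theorem nablaJ_eq_zero (hflat : H.toLieMetric.IsFlat) (x : 𝔤) : H.nablaJ x = 0 := by
  have hJJ : H.J * H.J = -1 := LinearMap.ext fun y => H.J_sq y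
  have hcomm : H.nabla x * H.nabla (H.J x) = H.nabla (H.J x) * H.nabla x :=
    LinearMap.ext fun y => hflat.nabla_comm x (H.J x) y
  have hTJ : H.nablaJ x * H.J = -(H.J * H.nablaJ x) := LinearMap.ext fun y => H.nablaJ_J x y
  have h1 : LinearMap.trace ℝ 𝔤 (H.nablaJ x * H.nabla (H.J x)) = 0 := by
    rw [nablaJ, sub_mul, map_sub, mul_assoc, mul_assoc, hcomm,
      LinearMap.trace_mul_comm ℝ (H.nabla x), ← mul_assoc H.J, sub_self]
  have h2 : LinearMap.trace ℝ 𝔤 (H.nablaJ x * (H.J * H.nabla (H.J x) * H.J)) = 0 := by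
    rw [← h1, ← mul_assoc, LinearMap.trace_mul_comm, ← mul_assoc, ← mul_assoc, mul_assoc H.J, hTJ,
      mul_neg, ← mul_assoc, hJJ, neg_one_mul, neg_neg]
  have hb : H.nabla (H.J x) * H.J = H.J * H.nabla (H.J x) + H.J * H.nablaJ x := by
    rw [← H.nablaJ_J_left, nablaJ]; abel
  have h4 : H.J * H.nabla (H.J x) * H.J = -H.nabla (H.J x) - H.nablaJ x := by
    rw [mul_assoc, hb, mul_add, ← mul_assoc, ← mul_assoc, hJJ]
    simp only [neg_one_mul]
    abel
  rw [h4, mul_sub, mul_neg, map_sub, map_neg, h1, neg_zero, zero_sub, neg_eq_zero] at h2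
  exact LinearMap.BilinForm.eq_zero_of_skew_of_trace_comp_self H.g_symm H.g_pos
    (H.nablaJ_skew x) h2

theorem nabla_J (hflat : H.toLieMetric.IsFlat) (x y : 𝔤) :
    H.nabla x (H.J y) = H.J (H.nabla x y) := by
  rw [← sub_eq_zero, ← H.nablaJ_apply, H.nablaJ_eq_zero hflat, LinearMap.zero_apply]

theorem isKahler_of_isFlat (hflat : H.toLieMetric.IsFlat) : H.IsKahler := by
  have key : ∀ x y z, H.g (H.J (H.nabla x y)) z = H.g (H.J (H.nabla x z)) y := by
    intro x y z
    rw [H.g_J_left, H.nabla_skew, H.nabla_J hflat, H.g_symm y, neg_neg]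
  intro x y z
  simp only [omega, ← H.nabla_torsion_free, map_sub, LinearMap.sub_apply]
  rw [key x y z, key y z x, key z x y]
  ring

end HermitianStructure

/-! ### Commutator, center, and subspaces relative to `J` -/

namespace HermitianStructure

variable {𝔤 : Type*} [LieRing 𝔤] [LieAlgebra ℝ 𝔤]

section Commutator

theorem lie_mem_commutatorSpace (x y : 𝔤) : ⁅x, y⁆ ∈ commutatorSpace 𝔤 :=
  LieSubmodule.lie_mem_lie (LieSubmodule.mem_top x) (LieSubmodule.mem_top y)

theorem commutatorSpace_le {W : Submodule ℝ 𝔤} (h : ∀ x y : 𝔤, ⁅x, y⁆ ∈ W) :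
    commutatorSpace 𝔤 ≤ W := by
  rw [commutatorSpace, LieSubmodule.lieIdeal_oper_eq_linear_span', Submodule.span_le]
  rintro _ ⟨x, -, y, -, rfl⟩
  exact h x y

theorem mem_centerSpace {x : 𝔤} : x ∈ centerSpace 𝔤 ↔ ∀ y : 𝔤, ⁅y, x⁆ = 0 :=
  LieModule.mem_maxTrivSubmodule (R := ℝ) (L := 𝔤) (M := 𝔤) x

end Commutator

section ComplexStructure

variable (H : HermitianStructure 𝔤)

theorem mem_map_J {A : Submodule ℝ 𝔤} {x : 𝔤} : x ∈ A.map H.J ↔ H.J x ∈ A := by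
  constructor
  · rintro ⟨y, hy, rfl⟩
    rw [H.J_sq]
    exact A.neg_mem hy
  · intro h
    exact ⟨-H.J x, A.neg_mem h, by rw [map_neg, H.J_sq, neg_neg]⟩

theorem map_J_eq {A : Submodule ℝ 𝔤} (h : ∀ x ∈ A, H.J x ∈ A) : A.map H.J = A := by
  ext x
  rw [H.mem_map_J]
  refine ⟨fun hx => ?_, h x⟩
  simpa [H.J_sq] using h _ hx

/-- The orthogonal complement in `A` of its largest `J`-invariant subspace. -/
def totallyRealPart (A : Submodule ℝ 𝔤) : Submodule ℝ 𝔤 := A ⊓ H.g.orthogonal (A ⊓ A.map H.J)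

variable {H} in
theorem mem_totallyRealPart {A : Submodule ℝ 𝔤} {x : 𝔤} : x ∈ H.totallyRealPart A ↔
    x ∈ A ∧ ∀ y, y ∈ A → H.J y ∈ A → H.g y x = 0 := by
  rw [totallyRealPart, Submodule.mem_inf, LinearMap.BilinForm.mem_orthogonal_iff]
  simp only [Submodule.mem_inf, H.mem_map_J, and_imp]

theorem perp_totallyRealPart (A : Submodule ℝ 𝔤) :
    H.Perp (A ⊓ A.map H.J) (H.totallyRealPart A) :=
  fun x hx _ hy => (mem_totallyRealPart.mp hy).2 x hx.1 (H.mem_map_J.mp hx.2)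

theorem Perp.symm {H : HermitianStructure 𝔤} {A B : Submodule ℝ 𝔤} (h : H.Perp A B) :
    H.Perp B A := fun x hx y hy => by rw [H.g_symm, h y hy x hx]

variable {H} in
-- `J x` is orthogonal to the largest `J`-invariant subspaces of both `A` and `B`, since `J`
-- preserves each and `x` is orthogonal to both. Its components inherit this because `A ⊥ B`.
theorem exists_add_totallyRealPart {A B : Submodule ℝ 𝔤} (hAB : H.Perp A B) {x : 𝔤}
    (hJ : H.J x ∈ A ⊔ B) (hx : x ∈ H.totallyRealPart A) :
    ∃ a ∈ H.totallyRealPart A, ∃ b ∈ H.totallyRealPart B, a + b = H.J x := by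
  obtain ⟨a, ha, b, hb, hab⟩ := Submodule.mem_sup.mp hJ
  rw [mem_totallyRealPart] at hx
  refine ⟨a, mem_totallyRealPart.mpr ⟨ha, fun y hy hy' => ?_⟩, b,
    mem_totallyRealPart.mpr ⟨hb, fun y hy hy' => ?_⟩, hab⟩
  · have h1 : H.g y (H.J x) = 0 := by
      have := hx.2 (H.J y) hy' (by rw [H.J_sq]; exact A.neg_mem hy)
      rw [H.g_J_left] at this
      linarith
    rw [← hab, map_add, hAB y hy b hb, add_zero] at h1
    exact h1
  · have h1 : H.g y (H.J x) = 0 := by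
      have := hAB.symm (H.J y) hy' x hx.1
      rw [H.g_J_left] at this
      linarith
    rw [← hab, map_add, hAB.symm y hy a ha, zero_add] at h1
    exact h1

variable [FiniteDimensional ℝ 𝔤]

theorem sup_totallyRealPart (A : Submodule ℝ 𝔤) :
    (A ⊓ A.map H.J) ⊔ H.totallyRealPart A = A := by
  apply le_antisymm (sup_le inf_le_left inf_le_left)
  intro x hx
  have hc := LinearMap.BilinForm.isCompl_orthogonal_of_pos H.g_symm H.g_pos (A ⊓ A.map H.J)
  obtain ⟨y, hy, z, hz, rfl⟩ := Submodule.mem_sup.mp (hc.sup_eq_top ▸ Submodule.mem_top (x := x))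
  refine Submodule.add_mem_sup hy ⟨?_, hz⟩
  simpa using A.sub_mem hx hy.1

variable {H}

theorem exists_injective_totallyRealPart {A B : Submodule ℝ 𝔤} (hAB : H.Perp A B)
    (hJ : ∀ x ∈ A, H.J x ∈ A ⊔ B) :
    ∃ φ : H.totallyRealPart A →ₗ[ℝ] H.totallyRealPart B, Function.Injective φ ∧
      ∀ x : H.totallyRealPart A, H.J (x : 𝔤) - (φ x : 𝔤) ∈ H.totallyRealPart A := by
  have hc := LinearMap.BilinForm.isCompl_orthogonal_of_pos H.g_symm H.g_pos B
  have hAc : A ≤ H.g.orthogonal B := fun x hx y hy => hAB.symm y hy x hx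
  let P : 𝔤 →ₗ[ℝ] 𝔤 := B.subtype ∘ₗ B.projectionOnto _ hc
  have hP : ∀ a ∈ A, ∀ b ∈ B, P (a + b) = b := by
    intro a ha b hb
    have h1 : B.projectionOnto _ hc a = 0 :=
      (Submodule.projectionOnto_apply_eq_zero_iff hc).mpr (hAc ha)
    have h2 : B.projectionOnto _ hc b = ⟨b, hb⟩ :=
      Submodule.projectionOnto_apply_left hc ⟨b, hb⟩
    simp [P, h1, h2]
  have key : ∀ x : H.totallyRealPart A, P (H.J x) ∈ H.totallyRealPart B ∧
      H.J x - P (H.J x) ∈ H.totallyRealPart A := by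
    intro x
    obtain ⟨a, ha, b, hb, hab⟩ := exists_add_totallyRealPart hAB (hJ x x.2.1) x.2
    rw [← hab, hP a ha.1 b hb.1]
    exact ⟨hb, by simpa using ha⟩
  refine ⟨(P ∘ₗ H.J ∘ₗ (H.totallyRealPart A).subtype).codRestrict _ fun x => (key x).1, ?_,
    fun x => (key x).2⟩
  rw [injective_iff_map_eq_zero]
  intro x hx
  have h0 : P (H.J x) = 0 := congrArg Subtype.val hx
  have h1 := (key x).2
  rw [h0, sub_zero] at h1
  -- With zero `B`-component, `J x` lies in `A`, so `x` lies in `A ⊓ J A` and is orthogonal to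
  -- itself.
  by_contra hne
  exact (H.g_pos x fun h => hne (Subtype.ext h)).ne'
    ((mem_totallyRealPart.mp x.2).2 x x.2.1 h1.1)

theorem exists_equiv_totallyRealPart {A B : Submodule ℝ 𝔤} (hAB : H.Perp A B)
    (hJ : ∀ x ∈ A ⊔ B, H.J x ∈ A ⊔ B) :
    ∃ φ : H.totallyRealPart A ≃ₗ[ℝ] H.totallyRealPart B,
      ∀ x : H.totallyRealPart A, H.J (x : 𝔤) - (φ x : 𝔤) ∈ H.totallyRealPart A := by
  obtain ⟨φ, hφ, hφ'⟩ := exists_injective_totallyRealPart hAB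
    fun x hx => hJ x (Submodule.mem_sup_left hx)
  -- The reverse injection serves only to equate the dimensions.
  obtain ⟨ψ, hψ, -⟩ := exists_injective_totallyRealPart hAB.symm
    fun x hx => sup_comm A B ▸ hJ x (Submodule.mem_sup_right hx)
  exact ⟨φ.linearEquivOfInjective hφ ((LinearMap.finrank_le_finrank_of_injective hφ).antisymm
    (LinearMap.finrank_le_finrank_of_injective hψ)), hφ'⟩

omit [FiniteDimensional ℝ 𝔤] in
theorem map_J_sup_totallyRealPart {A B : Submodule ℝ 𝔤} (hAB : H.Perp A B)
    (hJ : ∀ x ∈ A ⊔ B, H.J x ∈ A ⊔ B) :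
    (H.totallyRealPart A ⊔ H.totallyRealPart B).map H.J
      = H.totallyRealPart A ⊔ H.totallyRealPart B := by
  apply H.map_J_eq
  intro x hx
  obtain ⟨a, ha, b, hb, rfl⟩ := Submodule.mem_sup.mp hx
  rw [map_add]
  apply Submodule.add_mem
  · obtain ⟨c, hc, d, hd, h⟩ :=
      exists_add_totallyRealPart hAB (hJ a (Submodule.mem_sup_left ha.1)) ha
    exact h ▸ Submodule.add_mem_sup hc hd
  · obtain ⟨c, hc, d, hd, h⟩ := exists_add_totallyRealPart hAB.symm
      (sup_comm A B ▸ hJ b (Submodule.mem_sup_right hb.1)) hb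
    rw [← h, add_comm]
    exact Submodule.add_mem_sup hd hc

end ComplexStructure

/-! ### Structure of a flat Hermitian Lie algebra -/

section Flat

variable [FiniteDimensional ℝ 𝔤] {m : LieMetric 𝔤}

open LieMetric

theorem lie_eq_nabla (x : 𝔤) {y : 𝔤} (hy : y ∈ m.nullity) : ⁅x, y⁆ = m.nabla x y := by
  rw [← m.nabla_torsion_free, mem_nullity.mp hy, sub_zero]

theorem nabla_eq_zero_of_mem_conullity (hflat : m.IsFlat) (x : 𝔤) {y : 𝔤} (hy : y ∈ m.conullity) :
    m.nabla x y = 0 := by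
  obtain ⟨u, hu, b, hb, rfl⟩ := m.exists_eq_add x
  rw [map_add, LinearMap.add_apply, mem_nullity.mp hu, hflat.nabla_conullity hb hy, zero_add]

theorem nabla_mem_commutatorSpace (hflat : m.IsFlat) (x y : 𝔤) :
    m.nabla x y ∈ commutatorSpace 𝔤 := by
  obtain ⟨u, hu, b, hb, rfl⟩ := m.exists_eq_add y
  rw [map_add, nabla_eq_zero_of_mem_conullity hflat x hb, add_zero, ← lie_eq_nabla x hu]
  exact lie_mem_commutatorSpace x u

theorem commutatorSpace_le_nullity (hflat : m.IsFlat) : commutatorSpace 𝔤 ≤ m.nullity :=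
  commutatorSpace_le hflat.lie_mem_nullity

/-- The commutator contains the images of all `∇_y` and is spanned by differences of their values;
skewness turns orthogonality to these images into parallelism. -/
theorem mem_orthogonal_commutatorSpace_iff (hflat : m.IsFlat) {x : 𝔤} :
    x ∈ m.g.orthogonal (commutatorSpace 𝔤) ↔ ∀ y, m.nabla y x = 0 := by
  constructor
  · intro hx y
    apply m.eq_of_forall_g
    intro z
    have h := hx _ (nabla_mem_commutatorSpace hflat y z)
    have h' : m.g (m.nabla y z) x = 0 := h
    rw [m.nabla_skew, m.g_symm z] at h'
    simpa using h'
  · intro hx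
    have : commutatorSpace 𝔤 ≤ LinearMap.ker (m.g x) := commutatorSpace_le fun y z => by
      rw [LinearMap.mem_ker, m.g_symm, ← m.nabla_torsion_free, map_sub, LinearMap.sub_apply,
        m.nabla_skew, m.nabla_skew, hx, hx]
      simp
    intro y hy
    change m.g y x = 0
    rw [m.g_symm]
    exact this hy

theorem mem_centerSpace_iff_nabla (hflat : m.IsFlat) {x : 𝔤} :
    x ∈ centerSpace 𝔤 ↔ x ∈ m.nullity ∧ ∀ y, m.nabla y x = 0 := by
  rw [mem_centerSpace]
  constructor
  · intro h
    have hsw : ∀ y, m.nabla y x = m.nabla x y := fun y => by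
      rw [← sub_eq_zero, m.nabla_torsion_free, h]
    have hx : x ∈ m.nullity := by
      obtain ⟨u, hu, b, hb, rfl⟩ := m.exists_eq_add x
      rw [mem_nullity]
      intro y
      obtain ⟨u', hu', b', hb', rfl⟩ := m.exists_eq_add y
      rw [map_add, nabla_eq_zero_of_mem_conullity hflat _ hb', ← hsw, mem_nullity.mp hu', add_zero]
    exact ⟨hx, fun y => by rw [hsw, mem_nullity.mp hx]⟩
  · rintro ⟨h1, h2⟩ y
    rw [lie_eq_nabla y h1, h2]

theorem conullity_sup_center_sup_commutator (hflat : m.IsFlat) :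
    m.conullity ⊔ centerSpace 𝔤 ⊔ commutatorSpace 𝔤 = ⊤ := by
  rw [eq_top_iff]
  rintro x -
  obtain ⟨u, hu, b, hb, rfl⟩ := m.exists_eq_add x
  have hc := LinearMap.BilinForm.isCompl_orthogonal_of_pos m.g_symm m.g_pos (commutatorSpace 𝔤)
  obtain ⟨c, hc, k, hk, rfl⟩ :=
    Submodule.mem_sup.mp (hc.sup_eq_top ▸ Submodule.mem_top (x := u))
  have hkz : k ∈ centerSpace 𝔤 := by
    refine (mem_centerSpace_iff_nabla hflat).mpr
      ⟨?_, (mem_orthogonal_commutatorSpace_iff hflat).mp hk⟩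
    simpa using Submodule.sub_mem _ hu (commutatorSpace_le_nullity hflat hc)
  rw [show c + k + b = b + k + c by abel]
  exact Submodule.add_mem_sup (Submodule.add_mem_sup hb hkz) hc

theorem mem_conullity_sup_center_iff (hflat : m.IsFlat) {x : 𝔤} :
    x ∈ m.conullity ⊔ centerSpace 𝔤 ↔ ∀ y, m.nabla y x = 0 := by
  constructor
  · intro hx y
    obtain ⟨b, hb, z, hz, rfl⟩ := Submodule.mem_sup.mp hx
    rw [map_add, nabla_eq_zero_of_mem_conullity hflat y hb,
      ((mem_centerSpace_iff_nabla hflat).mp hz).2, add_zero]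
  · intro hx
    obtain ⟨u, hu, b, hb, rfl⟩ := m.exists_eq_add x
    rw [add_comm]
    refine Submodule.add_mem_sup hb ((mem_centerSpace_iff_nabla hflat).mpr ⟨hu, fun y => ?_⟩)
    simpa [nabla_eq_zero_of_mem_conullity hflat y hb] using hx y

variable {H : HermitianStructure 𝔤}

theorem perp_conullity {A : Submodule ℝ 𝔤} (hA : A ≤ H.nullity) : H.Perp H.conullity A :=
  fun x hx y hy => by
    rw [H.g_symm]
    exact hx y (hA hy)

theorem perp_center_commutator (hflat : H.toLieMetric.IsFlat) :
    H.Perp (centerSpace 𝔤) (commutatorSpace 𝔤) := fun x hx y hy => by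
  rw [H.g_symm]
  exact (mem_orthogonal_commutatorSpace_iff hflat).mpr
    ((mem_centerSpace_iff_nabla hflat).mp hx).2 y hy

theorem J_mem_commutatorSpace (hflat : H.toLieMetric.IsFlat) {x : 𝔤}
    (hx : x ∈ commutatorSpace 𝔤) : H.J x ∈ commutatorSpace 𝔤 := by
  have : commutatorSpace 𝔤 ≤ (commutatorSpace 𝔤).comap H.J := commutatorSpace_le fun x y => by
    rw [Submodule.mem_comap, ← H.nabla_torsion_free, map_sub, ← H.nabla_J hflat,
      ← H.nabla_J hflat]
    exact Submodule.sub_mem _ (nabla_mem_commutatorSpace hflat _ _)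
      (nabla_mem_commutatorSpace hflat _ _)
  exact this hx

theorem exists_rotation_basis (hflat : H.toLieMetric.IsFlat) :
    ∃ (p : ℕ) (ε : Fin p → 𝔤) (f : H.conullity →ₗ[ℝ] (Fin p → ℝ)),
      (∀ i j, H.g (ε i) (ε j) = if i = j then 1 else 0) ∧
      (∀ i j, H.g (H.J (ε i)) (H.J (ε j)) = if i = j then 1 else 0) ∧
      (∀ i j, H.g (ε i) (H.J (ε j)) = 0) ∧
      Submodule.span ℝ (Set.range ε ∪ Set.range (fun i => H.J (ε i))) = commutatorSpace 𝔤 ∧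
      (∀ (x : H.conullity) (i : Fin p), ⁅(x : 𝔤), ε i⁆ = f x i • H.J (ε i)) ∧
      (∀ (x : H.conullity) (i : Fin p), ⁅(x : 𝔤), H.J (ε i)⁆ = -(f x i • ε i)) ∧
      Function.Injective f ∧
      (∀ i : Fin p, ∃ x : H.conullity, f x i ≠ 0) := by
  obtain ⟨p, ε, χ, h1, h2, h3, h4⟩ := LinearMap.BilinForm.exists_unitary_eigenbasis
    H.g_symm H.g_pos H.J_sq H.g_J (S := fun k => H.J ∘ₗ H.nabla k)
    (fun k x y => by
      simp only [LinearMap.comp_apply, H.g_J_left, H.nabla_skew, H.nabla_J hflat, neg_neg])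
    (fun k l x => by
      simp only [LinearMap.comp_apply, H.nabla_J hflat, hflat.nabla_comm k l])
    (fun k x => by simp only [LinearMap.comp_apply, H.nabla_J hflat])
    (commutatorSpace 𝔤) (fun x hx => J_mem_commutatorSpace hflat hx)
    (fun k x _ => J_mem_commutatorSpace hflat (nabla_mem_commutatorSpace hflat k x))
  have hε : ∀ i, ε i ∈ commutatorSpace 𝔤 := fun i => by
    rw [← h3]; exact Submodule.subset_span (Or.inl ⟨i, rfl⟩)
  have hJε : ∀ i, H.J (ε i) ∈ commutatorSpace 𝔤 := fun i => J_mem_commutatorSpace hflat (hε i)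
  -- This equals `-χ i x`; the eigenvalues `χ` come without linearity in `x`, which the pairing with
  -- `J (ε i)` supplies.
  let f : H.conullity →ₗ[ℝ] (Fin p → ℝ) := LinearMap.pi fun i =>
    H.g (H.J (ε i)) ∘ₗ H.nabla.flip (ε i) ∘ₗ H.conullity.subtype
  have hf : ∀ (x : H.conullity) (i : Fin p), H.nabla x (ε i) = f x i • H.J (ε i) := by
    intro x i
    have h5 : H.nabla x (ε i) = -χ i x • H.J (ε i) := by
      have h6 := congrArg H.J (h4 i x)
      rw [LinearMap.comp_apply, H.J_sq, map_smul] at h6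
      rw [neg_smul, ← h6, neg_neg]
    have h7 : f x i = -χ i x := by
      change H.g (H.J (ε i)) (H.nabla x (ε i)) = _
      rw [h5, map_smul, H.g_J, h1, if_pos rfl, smul_eq_mul, mul_one]
    rw [h7, h5]
  have hfJ : ∀ (x : H.conullity) (i : Fin p), H.nabla x (H.J (ε i)) = -(f x i • ε i) := by
    intro x i
    rw [H.nabla_J hflat, hf, map_smul, H.J_sq, smul_neg]
  refine ⟨p, ε, f, h1, fun i j => by rw [H.g_J, h1], h2, h3, fun x i => ?_, fun x i => ?_, ?_, ?_⟩
  · rw [lie_eq_nabla _ (commutatorSpace_le_nullity hflat (hε i)), hf]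
  · rw [lie_eq_nabla _ (commutatorSpace_le_nullity hflat (hJε i)), hfJ]
  · rw [injective_iff_map_eq_zero]
    intro x hx
    -- `∇_x` also kills the parallel vectors, so it is zero and `x` lies in both the nullity and the
    -- conullity.
    have hker : commutatorSpace 𝔤 ≤ LinearMap.ker (H.nabla x) := by
      rw [← h3, Submodule.span_le]
      rintro _ (⟨i, rfl⟩ | ⟨i, rfl⟩)
      · simp [hf, hx]
      · simp [hfJ, hx]
    have hxu : (x : 𝔤) ∈ H.nullity := by
      have hK : H.conullity ⊔ centerSpace 𝔤 ≤ LinearMap.ker (H.nabla x) := fun y hy =>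
        (mem_conullity_sup_center_iff hflat).mp hy x
      rw [mem_nullity]
      intro y
      exact (conullity_sup_center_sup_commutator hflat ▸ sup_le hK hker :
        ⊤ ≤ LinearMap.ker (H.nabla x)) Submodule.mem_top
    exact Subtype.ext
      (Submodule.disjoint_def.mp H.isCompl_nullity_conullity.disjoint _ hxu x.2)
  · intro i
    by_contra! h0
    -- If `f_i` vanished, `ε i` would be parallel, hence orthogonal to the commutator that contains
    -- it.
    have hpar : ∀ y, H.nabla y (ε i) = 0 := by
      intro y
      obtain ⟨u, hu, b, hb, rfl⟩ := H.exists_eq_add y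
      rw [map_add, LinearMap.add_apply, mem_nullity.mp hu, zero_add, hf ⟨b, hb⟩ i, h0, zero_smul]
    have h5 : H.g (ε i) (ε i) = 0 :=
      (mem_orthogonal_commutatorSpace_iff hflat).mpr hpar _ (hε i)
    rw [h1, if_pos rfl] at h5
    exact one_ne_zero h5

theorem hasKahlerFlatStructure_of_isFlat (hflat : H.toLieMetric.IsFlat) :
    H.HasKahlerFlatStructure := by
  have hz : centerSpace 𝔤 ≤ H.nullity := fun x hx => ((mem_centerSpace_iff_nabla hflat).mp hx).1
  have hperp : H.Perp H.conullity (centerSpace 𝔤) := perp_conullity hz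
  have hJ : ∀ x ∈ H.conullity ⊔ centerSpace 𝔤, H.J x ∈ H.conullity ⊔ centerSpace 𝔤 := by
    intro x hx
    rw [mem_conullity_sup_center_iff hflat] at hx ⊢
    intro y
    rw [H.nabla_J hflat, hx, map_zero]
  refine ⟨H.conullity, ⟨conullity_sup_center_sup_commutator hflat, hperp,
    perp_conullity (commutatorSpace_le_nullity hflat), perp_center_commutator hflat⟩, ?_, ?_,
    H.map_J_eq fun x hx => J_mem_commutatorSpace hflat hx, exists_rotation_basis hflat,
    H.totallyRealPart H.conullity, H.totallyRealPart (centerSpace 𝔤), H.sup_totallyRealPart _,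
    H.perp_totallyRealPart _, H.sup_totallyRealPart _, H.perp_totallyRealPart _,
    map_J_sup_totallyRealPart hperp hJ, exists_equiv_totallyRealPart hperp hJ⟩
  · intro x hx y hy
    rw [← H.nabla_torsion_free, hflat.nabla_conullity hx hy, hflat.nabla_conullity hy hx, sub_zero]
  · intro x hx y hy
    rw [lie_eq_nabla x (commutatorSpace_le_nullity hflat hy),
      mem_nullity.mp (commutatorSpace_le_nullity hflat hx)]

end Flat

end HermitianStructure

theorem theorem3 {𝔤 : Type*} [LieRing 𝔤] [LieAlgebra ℝ 𝔤] [FiniteDimensional ℝ 𝔤]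
    (H : HermitianStructure 𝔤) (hflat : H.toLieMetric.IsFlat) :
    H.IsKahler ∧ H.HasKahlerFlatStructure :=
  ⟨H.isKahler_of_isFlat hflat, HermitianStructure.hasKahlerFlatStructure_of_isFlat hflat⟩
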